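/- Let $G$ be a finite connected plane bipartite graph (multiple edges allowed) with color classes $E$ and $V$, embedded in the oriented sphere $S^2$; the embedding is considered up to isotopy, i.e. it is given by the counterclockwise cyclic orders of the edges around the vertices, subject to Euler's formula. Let $G^*$ be its planar dual, whose vertex set $R$ is the set of regions of $G$ and whose edges are directed so that each has an element of $E$ on its right and an element of $V$ on its left. Fix a root $r_0\in R$ and an edge $\kappa$ of $G$ whose dual edge $\kappa^*$ points to $r_0$. An arborescence of $G^*$ rooted at $r_0$ is a set $A$ of edges of $G^*$ such that in the graph $(R,A)$ all components other than that of $r_0$ are isolated points without edges, while the component of $r_0$ (the root component) is a tree in which every vertex is reached from $r_0$ by a directed path. It is spanning if its root component contains all of $R$. The tree of arborescences is the binary tree of pairs $(A,S)$ with root $(\varnothing,\varnothing)$ that is defined as follows. Let $(A,S)$ be a node. Walk counterclockwise once around the boundary of a thin regular neighborhood of the root component of $A$, starting where $\kappa^*$ crosses it near its endpoint $r_0$, and let $\delta$ be the first edge of $G^*$ met that is not in $A\cup S$ and for which $A\cup\{\delta\}$ is an arborescence rooted at $r_0$. If $\delta$ exists, then $(A,S)$ has the two descendants $(A\cup\{\delta\},S)$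 and $(A,S\cup\{\delta\})$; otherwise $(A,S)$ is a leaf. The elements of $S$ are the skipped edges. A leaf $(A,S)$ is of type I if $A$ is spanning. A function $\pi\colon R\setminus\{r_0\}\to\mathbb N=\{0,1,2,\dots\}$ is a parking function of $G^*$ with respect to $r_0$ if every non-empty subset $R'\subset R\setminus\{r_0\}$ contains a vertex $r$ such that $\pi(r)$ is less than the number of edges of $G^*$ with endpoint $r$ and startpoint outside of $R'$. For a type I leaf $(A,S)$ and $r\in R\setminus\{r_0\}$, let $\pi_S(r)$ be the number of edges in $S$ whose endpoint is $r$. **Theorem.** (i) For every type I leaf $(A,S)$, the function $\pi_S$ is a parking function of $G^*$ with respect to $r_0$. (ii) For every spanning arborescence $A$ of $G^*$ rooted at $r_0$ there is a unique $S$ such that $(A,S)$ is a type I leaf. (iii) For every parking function $\pi$ of $G^*$ with respect to $r_0$ there is a unique spanning arborescence $A$ rooted at $r_0$ that has $\pi_S=\pi$ for the set $S$ of (ii). Thus $A\mapsto\pi_S$ is a bijection from the spanning arborescences of $G^*$ rooted at $r_0$ onto the parking functions of $G^*$ with respect to $r_0$. -/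

import Mathlib

/-- A directed graph with vertex set `R` and edge set `C`; multiple edges and loops are allowed.
A subgraph is a set of edges (on the same vertex set). -/
structure DiMultigraph (R C : Type*) where
  /-- the startpoint of an edge -/
  src : C → R
  /-- the endpoint of an edge -/
  tgt : C → R

namespace DiMultigraph

variable {R C : Type*} (J : DiMultigraph R C)

/-- `x` and `y` lie in the same connected component of the subgraph `A`
(edge directions are ignored). -/
def Connected (A : Set C) (x y : R) : Prop :=
  Relation.EqvGen (fun p q => ∃ c ∈ A, J.src c = p ∧ J.tgt c = q) x y

/-- There is a directed path from `x` to `y` in the subgraph `A`. -/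
def DirReachable (A : Set C) (x y : R) : Prop :=
  Relation.ReflTransGen (fun p q => ∃ c ∈ A, J.src c = p ∧ J.tgt c = q) x y

/-- The subgraph `A` has no cycle: deleting any of its edges disconnects the two ends of
that edge. In particular `A` contains no loop and at most one edge between two vertices. -/
def CycleFree (A : Set C) : Prop :=
  ∀ c ∈ A, ¬ J.Connected (A \ {c}) (J.src c) (J.tgt c)

/-- The vertex set of the connected component of the root in the subgraph `A`. -/
def rootComponent (r₀ : R) (A : Set C) : Set R := {r | J.Connected A r₀ r}

/-- Arborescences rooted at `r₀`. -/
structure IsArborescence (r₀ : R) (A : Set C) : Prop where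
  /-- Components other than the root component are isolated points: they carry no edge. -/
  edge_mem : ∀ c ∈ A, J.src c ∈ J.rootComponent r₀ A ∧ J.tgt c ∈ J.rootComponent r₀ A
  /-- The root component, which carries all edges, is a tree. -/
  cycleFree : J.CycleFree A
  /-- Every vertex of the root component is the end of a directed path from the root. -/
  reachable : ∀ r ∈ J.rootComponent r₀ A, J.DirReachable A r₀ r

/-- A spanning arborescence: the root component contains all vertices. -/
def IsSpanningArborescence (r₀ : R) (A : Set C) : Prop :=
  J.IsArborescence r₀ A ∧ ∀ r, r ∈ J.rootComponent r₀ A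

/-- The relative in-degree of `r` with respect to a set `T` of vertices: the number of edges
with endpoint `r` and startpoint outside of `T`. -/
noncomputable def relInDegree (T : Set R) (r : R) : ℕ :=
  {c | J.tgt c = r ∧ J.src c ∉ T}.ncard

/-- Parking functions with respect to the root `r₀`. -/
def IsParkingFunction (r₀ : R) (π : {r : R // r ≠ r₀} → ℕ) : Prop :=
  ∀ T : Set {r : R // r ≠ r₀}, T.Nonempty →
    ∃ r ∈ T, π r < J.relInDegree (Subtype.val '' T) r

/-- For each non-root vertex, the number of edges of `S` that point to it. -/
noncomputable def inCount (r₀ : R) (S : Set C) (r : {r : R // r ≠ r₀}) : ℕ :=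
  {c | c ∈ S ∧ J.tgt c = r}.ncard

end DiMultigraph

/-- The two halves of a directed edge: the one at its startpoint (`out c`) and the one at its
endpoint (`inc c`). -/
inductive HalfEdge (C : Type*) where
  | out (c : C) : HalfEdge C
  | inc (c : C) : HalfEdge C

namespace HalfEdge

variable {C : Type*}

/-- the edge that a half-edge belongs to -/
def edge : HalfEdge C → C
  | out c => c
  | inc c => c

/-- the other half of the same edge -/
def flip : HalfEdge C → HalfEdge C
  | out c => inc c
  | inc c => out c

end HalfEdge

/-- A bipartite graph with color classes `E`, `V` and edge set `C` (multiple edges allowed),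
embedded in an oriented surface. The embedding is recorded, up to isotopy, by the
counterclockwise cyclic order of the edges around each vertex (a rotation system). -/
structure EmbeddedBipartiteGraph (E V C : Type*) where
  /-- the vertex of the edge in the color class `E` -/
  endE : C → E
  /-- the vertex of the edge in the color class `V` -/
  endV : C → V
  /-- the next edge counterclockwise around the `E`-vertex of the edge -/
  rotE : Equiv.Perm C
  /-- the next edge counterclockwise around the `V`-vertex of the edge -/
  rotV : Equiv.Perm C
  /-- the edges around an `E`-vertex are permuted in a single cycle -/
  sameCycle_rotE : ∀ a b : C, rotE.SameCycle a b ↔ endE a = endE b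
  /-- the edges around a `V`-vertex are permuted in a single cycle -/
  sameCycle_rotV : ∀ a b : C, rotV.SameCycle a b ↔ endV a = endV b

namespace EmbeddedBipartiteGraph

variable {E V C : Type*} (G : EmbeddedBipartiteGraph E V C)

/-- The dual edge of `c` crosses `c` with its `E`-vertex on the right and its `V`-vertex on the
left. So it starts in the region to the left of `c`, and ends in the region to the right of `c`,
when `c` is traversed from `E` to `V`.

`dualRot` sends each half of a dual edge to the next one counterclockwise around the region of
`G` that contains it, i.e. it walks along the boundary of that region with the region on the left.
At `out c` one walks along `c` to its `V`-vertex, and the next edge of the boundary is the one that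
precedes `c` around that vertex; it is crossed by a dual edge that enters the region.
At `inc c` one walks along `c` to its `E`-vertex, and the next edge of the boundary is the one that
precedes `c` around that vertex; it is crossed by a dual edge that leaves the region. -/
def dualRot : Equiv.Perm (HalfEdge C) where
  toFun
    | .out c => .inc (G.rotV.symm c)
    | .inc c => .out (G.rotE.symm c)
  invFun
    | .out c => .inc (G.rotE c)
    | .inc c => .out (G.rotV c)
  left_inv h := by cases h <;> simp
  right_inv h := by cases h <;> simp

/-- The regions of `G`: one for each closed boundary walk. They are the vertices of the dual
graph, and the boundary walk is the cyclic order of the dual half-edges around that vertex. -/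
def Region : Type _ := Quotient (Equiv.Perm.SameCycle.setoid G.dualRot)

/-- The region containing a half of a dual edge. -/
def regionOf (h : HalfEdge C) : G.Region := Quotient.mk _ h

/-- The planar dual, with its edges (identified with the edges of `G`) directed so that
there is an element of `E` to the right and an element of `V` to the left. -/
def dual : DiMultigraph G.Region C where
  src c := G.regionOf (.out c)
  tgt c := G.regionOf (.inc c)

/-- The graph `G` itself, without the embedding; its edges are directed from `E` to `V`. -/
def toGraph : DiMultigraph (E ⊕ V) C where
  src c := Sum.inl (G.endE c)
  tgt c := Sum.inr (G.endV c)

/-- `G` is a connected plane graph (with at least one edge): it is connected and Euler's formula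
holds, so that the surface in which the rotation system is embedded with disks as regions
is the sphere. -/
structure IsConnectedPlane : Prop where
  connected : ∀ x y : E ⊕ V, G.toGraph.Connected Set.univ x y
  euler : Nat.card (E ⊕ V) + Nat.card G.Region = Nat.card C + 2

open Classical in
/-- One step of the counterclockwise walk around the boundary of the regular neighborhood of an
arborescence `A` of the dual graph. From a half-edge outside of `A`, which crosses that boundary,
turn counterclockwise to the next half-edge at the same vertex. If a half of an edge of `A` has
been met, follow this edge to its other end first and turn counterclockwise there. -/
noncomputable def tourStep (A : Set C) (h : HalfEdge C) : HalfEdge C :=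
  if h.edge ∈ A then G.dualRot h.flip else G.dualRot h

/-- The edge that is met after `n` steps of the walk around the regular neighborhood of `A`.
The walk starts at the half of the dual edge of `κ` that points to the root, and it goes around
forever. Edges of `A` occur where the walk follows them, all other edges occur where they cross
the boundary of the neighborhood. -/
noncomputable def tourEdge (κ : C) (A : Set C) (n : ℕ) : C :=
  ((G.tourStep A)^[n] (.inc κ)).edge

/-- `c` is neither in the arborescence nor skipped, and adding it to `A` gives an arborescence. -/
def CanAugment (r₀ : G.Region) (A S : Set C) (c : C) : Prop :=
  c ∉ A ∧ c ∉ S ∧ G.dual.IsArborescence r₀ (insert c A)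

/-- `δ` is the augmenting edge of `(A, S)`: the first suitable edge along the walk. -/
def IsAugmentingEdge (r₀ : G.Region) (κ : C) (A S : Set C) (δ : C) : Prop :=
  ∃ n : ℕ, G.tourEdge κ A n = δ ∧ G.CanAugment r₀ A S δ ∧
    ∀ m < n, ¬ G.CanAugment r₀ A S (G.tourEdge κ A m)

/-- `(A, S)` is a node of the tree of arborescences: `A` is an arborescence, and `S` is
the set of skipped edges. -/
inductive IsNode (r₀ : G.Region) (κ : C) : Set C → Set C → Prop
  | root : IsNode r₀ κ ∅ ∅
  | right {A S : Set C} {δ : C} : IsNode r₀ κ A S → G.IsAugmentingEdge r₀ κ A S δ →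
      IsNode r₀ κ (insert δ A) S
  | left {A S : Set C} {δ : C} : IsNode r₀ κ A S → G.IsAugmentingEdge r₀ κ A S δ →
      IsNode r₀ κ A (insert δ S)

/-- A leaf of the tree of arborescences: a node without descendants. -/
def IsLeaf (r₀ : G.Region) (κ : C) (A S : Set C) : Prop :=
  G.IsNode r₀ κ A S ∧ ∀ δ, ¬ G.IsAugmentingEdge r₀ κ A S δ

/-- A leaf is of type I if its arborescence is spanning. -/
def IsTypeILeaf (r₀ : G.Region) (κ : C) (A S : Set C) : Prop :=
  G.IsLeaf r₀ κ A S ∧ G.dual.IsSpanningArborescence r₀ A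

end EmbeddedBipartiteGraph

/-! ### Connectivity and arborescences in directed multigraphs. -/

namespace DiMultigraph

variable {R C : Type*} {J : DiMultigraph R C}

/-! An edge can be added to an arborescence exactly when it leaves the root component
(`IsArborescence.insert_iff`). Adding it merges two cycles of the walk, so the walk always meets
every half-edge at the root component (`IsNode.sameCycle_tourPerm`); hence at a leaf every edge
leaving that component has been skipped (`IsLeaf.mem_of_leaves`).

Existence: descend by a rule dictated by the target, namely add the augmenting edge iff it lies in
the given arborescence, or iff its endpoint has already received `π` many skipped edges. The leaf
property forces the result to be spanning.

Uniqueness: two different leaves diverge at a node whose augmenting edge one adds and the other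
skips (`IsDescendant.eq_or_diverge`). Their arborescences then differ, and so do their counts at the
endpoint of this edge: adding it freezes the count, skipping it increases the count.

Parking: when a set of vertices is first entered, the skipped edges at the entered vertex, together
with the entering edge, all come from outside the set (`IsNode.exists_inCount_lt`). -/

theorem Connected.refl (A : Set C) (x : R) : J.Connected A x x := Relation.EqvGen.refl x

theorem Connected.symm {A : Set C} {x y : R} (h : J.Connected A x y) : J.Connected A y x :=
  Relation.EqvGen.symm _ _ h

theorem Connected.trans {A : Set C} {x y z : R} (h : J.Connected A x y)
    (h' : J.Connected A y z) : J.Connected A x z := Relation.EqvGen.trans _ _ _ h h'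

theorem Connected.of_mem {A : Set C} {c : C} (h : c ∈ A) : J.Connected A (J.src c) (J.tgt c) :=
  Relation.EqvGen.rel _ _ ⟨c, h, rfl, rfl⟩

/-- An equivalence relation that relates the images of the two ends of each edge relates
the images of connected vertices. -/
theorem Connected.lift {R' : Type*} {A : Set C} {r : R' → R' → Prop} (hr : Equivalence r)
    (f : R → R') (hf : ∀ c ∈ A, r (f (J.src c)) (f (J.tgt c))) {x y : R}
    (h : J.Connected A x y) : r (f x) (f y) := by
  induction h with
  | rel x y h => obtain ⟨c, hc, rfl, rfl⟩ := h; exact hf c hc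
  | refl x => exact hr.refl _
  | symm x y _ ih => exact hr.symm ih
  | trans x y z _ _ ih ih' => exact hr.trans ih ih'

theorem Connected.mono {A B : Set C} (hAB : A ⊆ B) {x y : R} (h : J.Connected A x y) :
    J.Connected B x y :=
  h.lift (r := J.Connected B) ⟨Connected.refl B, Connected.symm, Connected.trans⟩ id
    fun _ hc => Connected.of_mem (hAB hc)

theorem Connected.mem_iff {A : Set C} {T : Set R} (hT : ∀ c ∈ A, J.src c ∈ T ↔ J.tgt c ∈ T)
    {x y : R} (h : J.Connected A x y) : x ∈ T ↔ y ∈ T :=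
  h.lift (r := Iff) ⟨fun _ => Iff.rfl, Iff.symm, Iff.trans⟩ (· ∈ T) hT

theorem root_mem_rootComponent (r₀ : R) (A : Set C) : r₀ ∈ J.rootComponent r₀ A :=
  Connected.refl A r₀

theorem rootComponent_mono {r₀ : R} {A B : Set C} (hAB : A ⊆ B) :
    J.rootComponent r₀ A ⊆ J.rootComponent r₀ B := fun _ h => Connected.mono hAB h

theorem eq_of_mem_rootComponent_empty {r₀ r : R} (h : r ∈ J.rootComponent r₀ (∅ : Set C)) :
    r = r₀ := by
  have := (Connected.mem_iff (T := {r₀}) (by simp) h).1 rfl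
  simpa using this

theorem isArborescence_empty (r₀ : R) : J.IsArborescence r₀ (∅ : Set C) where
  edge_mem := by simp
  cycleFree := by simp [CycleFree]
  reachable r hr := by rw [eq_of_mem_rootComponent_empty hr]; exact Relation.ReflTransGen.refl

theorem DirReachable.mono {A B : Set C} (hAB : A ⊆ B) {x y : R} (h : J.DirReachable A x y) :
    J.DirReachable B x y :=
  Relation.ReflTransGen.mono (r := fun p q => ∃ c ∈ A, J.src c = p ∧ J.tgt c = q)
    (fun _ _ ⟨c, hc, h⟩ => ⟨c, hAB hc, h⟩) _ _ h

/-- A directed path that leaves a set of vertices has an edge that leaves this set. -/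
theorem DirReachable.exists_leaving_edge {A : Set C} {T : Set R} {x y : R}
    (h : J.DirReachable A x y) (hx : x ∈ T) (hy : y ∉ T) :
    ∃ c ∈ A, J.src c ∈ T ∧ J.tgt c ∉ T := by
  induction h with
  | refl => exact absurd hx hy
  | @tail y z _ hyz ih =>
    by_cases h : y ∈ T
    · obtain ⟨c, hc, rfl, rfl⟩ := hyz
      exact ⟨c, hc, h, hy⟩
    · exact ih h

theorem IsArborescence.rootComponent_insert {r₀ : R} {A : Set C} (hA : J.IsArborescence r₀ A)
    {c : C} (hs : J.src c ∈ J.rootComponent r₀ A) :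
    J.rootComponent r₀ (insert c A) = insert (J.tgt c) (J.rootComponent r₀ A) := by
  apply Set.Subset.antisymm
  · intro x hx
    refine (Connected.mem_iff (T := insert (J.tgt c) (J.rootComponent r₀ A)) ?_ hx).1
      (Or.inr (root_mem_rootComponent _ _))
    rintro d (rfl | hd)
    · exact ⟨fun _ => Or.inl rfl, fun _ => Or.inr hs⟩
    · exact ⟨fun _ => Or.inr (hA.edge_mem d hd).2, fun _ => Or.inr (hA.edge_mem d hd).1⟩
  · rintro x (rfl | hx)
    · exact (rootComponent_mono (Set.subset_insert c A) hs : J.Connected _ _ _).trans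
        (Connected.of_mem (Set.mem_insert c A))
    · exact rootComponent_mono (Set.subset_insert c A) hx

/-- An edge without contact to `A` at its endpoint creates no new connections in `A`. -/
theorem Connected.of_insert {A : Set C} {c : C}
    (hA : ∀ d ∈ A, J.src d ≠ J.tgt c ∧ J.tgt d ≠ J.tgt c) {x y : R}
    (hx : x ≠ J.tgt c) (hy : y ≠ J.tgt c) (h : J.Connected (insert c A) x y) :
    J.Connected A x y := by
  classical
  -- Contract `c` by moving its endpoint to its startpoint: `c` becomes a loop, and the edges of `A`
  -- are unaffected.
  have := h.lift (r := J.Connected A) ⟨Connected.refl A, Connected.symm, Connected.trans⟩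
    (fun x => if x = J.tgt c then J.src c else x) (by
      rintro d (rfl | hd)
      · simp only [if_true, ite_self]
        exact Connected.refl _ _
      · simp only [if_neg (hA d hd).1, if_neg (hA d hd).2]
        exact Connected.of_mem hd)
  simpa only [if_neg hx, if_neg hy] using this

/-- The edges that extend an arborescence are those that leave its root component. -/
theorem IsArborescence.insert_iff {r₀ : R} {A : Set C} (hA : J.IsArborescence r₀ A) {c : C} :
    c ∉ A ∧ J.IsArborescence r₀ (insert c A) ↔
      J.src c ∈ J.rootComponent r₀ A ∧ J.tgt c ∉ J.rootComponent r₀ A := by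
  constructor
  · rintro ⟨hc, hB⟩
    have hcB : c ∈ insert c A := Set.mem_insert c A
    have hs : J.src c ∈ J.rootComponent r₀ A := by
      by_contra hs
      -- A directed path to the startpoint of `c` would have to leave the root component of `A`.
      -- Edges of `A` cannot do this, and `c` can only if it already starts there.
      obtain ⟨d, hd, h1, h2⟩ := (hB.reachable _ (hB.edge_mem c hcB).1).exists_leaving_edge
        (root_mem_rootComponent (J := J) r₀ A) hs
      rcases hd with rfl | hd
      · exact hs h1
      · exact h2 (hA.edge_mem d hd).2
    refine ⟨hs, fun ht => hB.cycleFree c hcB ?_⟩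
    rw [Set.insert_sdiff_self_of_notMem hc]
    exact Connected.trans (Connected.symm hs) ht
  · rintro ⟨hs, ht⟩
    refine ⟨fun hc => ht (hA.edge_mem c hc).2, ?_, ?_, ?_⟩
    · rw [hA.rootComponent_insert hs]
      rintro d (rfl | hd)
      · exact ⟨Or.inr hs, Or.inl rfl⟩
      · exact ⟨Or.inr (hA.edge_mem d hd).1, Or.inr (hA.edge_mem d hd).2⟩
    · have hne : ∀ d ∈ A, J.src d ≠ J.tgt c ∧ J.tgt d ≠ J.tgt c := fun d hd =>
        ⟨fun h => ht (h ▸ (hA.edge_mem d hd).1), fun h => ht (h ▸ (hA.edge_mem d hd).2)⟩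
      -- The new edge is pendant at its endpoint, so it is not on a cycle and helps no other edge to
      -- close one.
      intro d hd h
      by_cases hdc : d = c
      · subst hdc
        refine ht (Connected.trans hs (h.mono ?_))
        rintro e ⟨rfl | he, hed⟩
        · exact absurd rfl hed
        · exact he
      · have hdA : d ∈ A := hd.resolve_left hdc
        refine hA.cycleFree d hdA (Connected.of_insert (c := c) (fun e he => hne e he.1)
          (hne d hdA).1 (hne d hdA).2 (h.mono ?_))
        rintro e ⟨rfl | he, hed⟩
        · exact Or.inl rfl
        · exact Or.inr ⟨he, hed⟩
    · rw [hA.rootComponent_insert hs]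
      have key : ∀ r ∈ J.rootComponent r₀ A, J.DirReachable (insert c A) r₀ r := fun r hr =>
        (hA.reachable r hr).mono (Set.subset_insert c A)
      rintro r (rfl | hr)
      · exact Relation.ReflTransGen.tail (key _ hs) ⟨c, Set.mem_insert c A, rfl, rfl⟩
      · exact key r hr

/-- An arborescence contains no other arborescence with a spanning root component. -/
theorem IsArborescence.eq_of_subset {r₀ : R} {A B : Set C} (hB : J.IsArborescence r₀ B)
    (hAB : A ⊆ B) (hA : ∀ r, r ∈ J.rootComponent r₀ A) : A = B := by
  refine hAB.antisymm fun c hc => ?_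
  by_contra hcA
  refine hB.cycleFree c hc (Connected.mono (A := A) ?_ ?_)
  · exact fun d hd => ⟨hAB hd, fun h => hcA (h ▸ hd)⟩
  · exact Connected.trans (Connected.symm (hA _)) (hA _)

theorem inCount_insert_of_eq [Finite C] {r₀ : R} {S : Set C} {c : C} (hc : c ∉ S)
    {r : {r : R // r ≠ r₀}} (h : J.tgt c = r) :
    J.inCount r₀ (insert c S) r = J.inCount r₀ S r + 1 := by
  rw [inCount, inCount, ← Set.ncard_insert_of_notMem (a := c) (fun h => hc h.1) (Set.toFinite _)]
  congr 1
  ext d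
  simp only [Set.mem_insert_iff, Set.mem_ofPred_eq]
  constructor
  · rintro ⟨hd | hd, h'⟩
    · exact Or.inl hd
    · exact Or.inr ⟨hd, h'⟩
  · rintro (rfl | ⟨hd, h'⟩)
    · exact ⟨Or.inl rfl, h⟩
    · exact ⟨Or.inr hd, h'⟩

theorem inCount_insert_of_ne {r₀ : R} {S : Set C} {c : C} {r : {r : R // r ≠ r₀}}
    (h : J.tgt c ≠ r) : J.inCount r₀ (insert c S) r = J.inCount r₀ S r := by
  rw [inCount, inCount]
  congr 1
  ext d
  simp only [Set.mem_insert_iff, Set.mem_ofPred_eq]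
  constructor
  · rintro ⟨rfl | hd, h'⟩
    · exact absurd h' h
    · exact ⟨hd, h'⟩
  · exact fun ⟨hd, h'⟩ => ⟨Or.inr hd, h'⟩

theorem inCount_mono [Finite C] {r₀ : R} {S T : Set C} (h : S ⊆ T) (r : {r : R // r ≠ r₀}) :
    J.inCount r₀ S r ≤ J.inCount r₀ T r :=
  Set.ncard_le_ncard (fun _ hd => ⟨h hd.1, hd.2⟩) (Set.toFinite _)

end DiMultigraph

/-! ### Half-edges and the merging of permutation cycles. -/

instance HalfEdge.instFinite {C : Type*} [Finite C] : Finite (HalfEdge C) :=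
  Finite.of_surjective (fun p : C ⊕ C => p.elim HalfEdge.out HalfEdge.inc) (by
    rintro (c | c)
    · exact ⟨Sum.inl c, rfl⟩
    · exact ⟨Sum.inr c, rfl⟩)

theorem HalfEdge.flip_flip {C : Type*} (h : HalfEdge C) : h.flip.flip = h := by cases h <;> rfl

theorem HalfEdge.edge_flip {C : Type*} (h : HalfEdge C) : h.flip.edge = h.edge := by
  cases h <;> rfl

/-- If `a` and `b` lie in different cycles of `P`, then composing `P` with the exchange
of `a` and `b` joins the cycle of `a` to `b`. -/
theorem Equiv.Perm.SameCycle.merge {α : Type*} [Finite α] {P Q : Equiv.Perm α} {a b : α}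
    (hab : ¬ P.SameCycle a b) (hQb : Q b = P a) (hQ : ∀ x, x ≠ a → x ≠ b → Q x = P x)
    {x : α} (hx : P.SameCycle a x) : Q.SameCycle b x := by
  -- From `b`, `Q` enters the cycle of `a` just behind `a`, hence the exponent `n + 1`; the point
  -- `a` itself is reached only after a full turn.
  have key : ∀ n : ℕ, Q.SameCycle b ((P ^ (n + 1)) a) := by
    intro n
    induction n with
    | zero => rw [zero_add, pow_one, ← hQb]; exact Equiv.Perm.sameCycle_apply_right.2 (.refl _ _)
    | succ n ih =>
      rw [pow_succ', Equiv.Perm.mul_apply]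
      by_cases h : (P ^ (n + 1)) a = a
      · rw [h, ← hQb]; exact Equiv.Perm.sameCycle_apply_right.2 (.refl _ _)
      · rw [← hQ _ h fun h' => hab ⟨(n + 1 : ℕ), by rw [zpow_natCast]; exact h'⟩]
        exact Equiv.Perm.sameCycle_apply_right.2 ih
  obtain ⟨n, hn, -, rfl⟩ := hx.exists_pow_eq''
  obtain ⟨m, rfl⟩ := Nat.exists_eq_succ_of_ne_zero hn.ne'
  exact key m

namespace EmbeddedBipartiteGraph

open DiMultigraph

variable {E V C : Type*} {G : EmbeddedBipartiteGraph E V C} {r₀ : G.Region} {κ : C}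

/-! ### The walk around an arborescence as a permutation. -/

variable (G) in
open Classical in
/-- The walk around the neighborhood of `A`, as a permutation of the half-edges. -/
noncomputable def tourPerm (A : Set C) : Equiv.Perm (HalfEdge C) :=
  Equiv.trans
    (Function.Involutive.toPerm (fun h : HalfEdge C => if h.edge ∈ A then h.flip else h)
      (fun h => by by_cases hh : h.edge ∈ A <;> simp [hh, HalfEdge.edge_flip, HalfEdge.flip_flip]))
    G.dualRot

theorem tourPerm_apply (A : Set C) (h : HalfEdge C) : G.tourPerm A h = G.tourStep A h := by
  classical
  change G.dualRot (if h.edge ∈ A then h.flip else h) = _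
  unfold tourStep
  split_ifs <;> rfl

theorem tourPerm_of_mem {A : Set C} {h : HalfEdge C} (hh : h.edge ∈ A) :
    G.tourPerm A h = G.dualRot h.flip := by simp [tourPerm_apply, tourStep, hh]

theorem tourPerm_of_notMem {A : Set C} {h : HalfEdge C} (hh : h.edge ∉ A) :
    G.tourPerm A h = G.dualRot h := by simp [tourPerm_apply, tourStep, hh]

theorem tourPerm_insert_of_ne {A : Set C} {c : C} {h : HalfEdge C} (hh : h.edge ≠ c) :
    G.tourPerm (insert c A) h = G.tourPerm A h := by
  by_cases hA : h.edge ∈ A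
  · rw [tourPerm_of_mem hA, tourPerm_of_mem (Set.mem_insert_of_mem c hA)]
  · rw [tourPerm_of_notMem hA, tourPerm_of_notMem fun h' => h'.elim hh hA]

theorem regionOf_dualRot (h : HalfEdge C) : G.regionOf (G.dualRot h) = G.regionOf h :=
  Quotient.sound (Equiv.Perm.sameCycle_apply_left.2 (Equiv.Perm.SameCycle.refl _ _))

theorem sameCycle_dualRot_iff {h h' : HalfEdge C} :
    G.dualRot.SameCycle h h' ↔ G.regionOf h = G.regionOf h' :=
  ⟨fun hh => Quotient.sound hh, fun hh => Quotient.exact hh⟩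

theorem regionOf_mem_of_edge_mem {A : Set C} (hA : G.dual.IsArborescence r₀ A)
    {h : HalfEdge C} (hh : h.edge ∈ A) : G.regionOf h ∈ G.dual.rootComponent r₀ A := by
  cases h with
  | out c => exact (hA.edge_mem c hh).1
  | inc c => exact (hA.edge_mem c hh).2

/-- The walk changes its region only along edges of `A`, and these have both ends in the root
component. -/
theorem regionOf_mem_of_sameCycle [Finite C] {A : Set C} (hA : G.dual.IsArborescence r₀ A)
    {h h' : HalfEdge C} (hh : (G.tourPerm A).SameCycle h h')
    (hr : G.regionOf h ∈ G.dual.rootComponent r₀ A) :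
    G.regionOf h' ∈ G.dual.rootComponent r₀ A := by
  obtain ⟨n, rfl⟩ := hh.exists_nat_pow_eq
  clear hh
  induction n with
  | zero => exact hr
  | succ n ih =>
    rw [pow_succ', Equiv.Perm.mul_apply]
    generalize (G.tourPerm A ^ n) h = x at ih
    by_cases hx : x.edge ∈ A
    · rw [tourPerm_of_mem hx, regionOf_dualRot]
      exact regionOf_mem_of_edge_mem hA (by rwa [HalfEdge.edge_flip])
    · rwa [tourPerm_of_notMem hx, regionOf_dualRot]

/-- Around a vertex outside of the root component of `A`, the walk around `A` runs through all
half-edges. -/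
theorem sameCycle_tourPerm_of_notMem [Finite C] {A : Set C} (hA : G.dual.IsArborescence r₀ A)
    {h h' : HalfEdge C} (hr : G.regionOf h ∉ G.dual.rootComponent r₀ A)
    (hh : G.regionOf h = G.regionOf h') : (G.tourPerm A).SameCycle h h' := by
  obtain ⟨n, rfl⟩ := (sameCycle_dualRot_iff.2 hh).exists_nat_pow_eq
  clear hh
  have key : G.regionOf ((G.dualRot ^ n) h) = G.regionOf h ∧
      (G.tourPerm A).SameCycle h ((G.dualRot ^ n) h) := by
    induction n with
    | zero => exact ⟨rfl, Equiv.Perm.SameCycle.refl _ _⟩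
    | succ n ih =>
      rw [pow_succ', Equiv.Perm.mul_apply]
      refine ⟨(regionOf_dualRot _).trans ih.1, ?_⟩
      rw [← tourPerm_of_notMem fun hx => hr (ih.1 ▸ regionOf_mem_of_edge_mem hA hx)]
      exact Equiv.Perm.sameCycle_apply_right.2 ih.2
  exact key.2

/-! ### Nodes and leaves of the tree of arborescences. -/

theorem canAugment_iff {A S : Set C} (hA : G.dual.IsArborescence r₀ A) {c : C} :
    G.CanAugment r₀ A S c ↔ c ∉ S ∧ G.dual.src c ∈ G.dual.rootComponent r₀ A ∧
      G.dual.tgt c ∉ G.dual.rootComponent r₀ A := by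
  rw [← hA.insert_iff, CanAugment]
  tauto

theorem IsAugmentingEdge.canAugment {A S : Set C} {δ : C}
    (h : G.IsAugmentingEdge r₀ κ A S δ) : G.CanAugment r₀ A S δ := by
  obtain ⟨_, -, h, -⟩ := h
  exact h

theorem IsAugmentingEdge.unique {A S : Set C} {δ δ' : C}
    (h : G.IsAugmentingEdge r₀ κ A S δ) (h' : G.IsAugmentingEdge r₀ κ A S δ') : δ = δ' := by
  obtain ⟨n, rfl, hn, hn'⟩ := h
  obtain ⟨m, rfl, hm, hm'⟩ := h'
  rcases lt_trichotomy n m with h | rfl | h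
  · exact absurd hn (hm' n h)
  · rfl
  · exact absurd hm (hn' m h)

theorem IsNode.isArborescence {A S : Set C} (h : G.IsNode r₀ κ A S) :
    G.dual.IsArborescence r₀ A := by
  induction h with
  | root => exact isArborescence_empty r₀
  | right _ hδ _ => exact hδ.canAugment.2.2
  | left _ _ ih => exact ih

theorem IsNode.disjoint {A S : Set C} (h : G.IsNode r₀ κ A S) : Disjoint A S := by
  induction h with
  | root => exact disjoint_bot_left
  | right _ hδ ih => exact Set.disjoint_insert_left.2 ⟨hδ.canAugment.2.1, ih⟩
  | left _ hδ ih => exact Set.disjoint_insert_right.2 ⟨hδ.canAugment.1, ih⟩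

/-- Skipped edges start in the root component. -/
theorem IsNode.src_mem {A S : Set C} (h : G.IsNode r₀ κ A S) :
    ∀ c ∈ S, G.dual.src c ∈ G.dual.rootComponent r₀ A := by
  induction h with
  | root => simp
  | right _ _ ih => exact fun c hc => rootComponent_mono (Set.subset_insert _ _) (ih c hc)
  | left hn hδ ih =>
    rintro c (rfl | hc)
    · exact ((canAugment_iff hn.isArborescence).1 hδ.canAugment).2.1
    · exact ih c hc

/-- The walk around the neighborhood of `A` meets all half-edges at the root component. -/
theorem IsNode.sameCycle_tourPerm [Finite C] (hκ : G.dual.tgt κ = r₀) {A S : Set C}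
    (h : G.IsNode r₀ κ A S) : ∀ x : HalfEdge C, G.regionOf x ∈ G.dual.rootComponent r₀ A →
      (G.tourPerm A).SameCycle (.inc κ) x := by
  induction h with
  | root =>
    intro x hx
    have hP : G.tourPerm ∅ = G.dualRot := Equiv.ext fun h => tourPerm_of_notMem (by simp)
    rw [hP, sameCycle_dualRot_iff, eq_of_mem_rootComponent_empty hx]
    exact hκ
  | left _ _ ih => exact ih
  | @right A S δ hn hδ ih =>
    have hA := hn.isArborescence
    obtain ⟨-, hs, ht⟩ := (canAugment_iff hA).1 hδ.canAugment
    have hδA : δ ∉ A := hδ.canAugment.1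
    -- Adding `δ` exchanges the images of its two halves. These lie in different cycles, since only
    -- one of them is at the root component, so the exchange joins the cycles.
    have hab : ¬ (G.tourPerm A).SameCycle (.out δ) (.inc δ) := fun h =>
      ht (regionOf_mem_of_sameCycle hA h hs)
    have hout : G.tourPerm (insert δ A) (.out δ) = G.tourPerm A (.inc δ) := by
      rw [tourPerm_of_mem (by exact Set.mem_insert _ _), tourPerm_of_notMem (by exact hδA)]; rfl
    have hinc : G.tourPerm (insert δ A) (.inc δ) = G.tourPerm A (.out δ) := by
      rw [tourPerm_of_mem (by exact Set.mem_insert _ _), tourPerm_of_notMem (by exact hδA)]; rfl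
    have hne : ∀ x : HalfEdge C, x ≠ .out δ → x ≠ .inc δ →
        G.tourPerm (insert δ A) x = G.tourPerm A x := by
      intro x h1 h2
      refine tourPerm_insert_of_ne ?_
      rintro rfl
      cases x
      · exact h1 rfl
      · exact h2 rfl
    have h1 : ∀ x, (G.tourPerm A).SameCycle (.out δ) x →
        (G.tourPerm (insert δ A)).SameCycle (.inc δ) x := fun x =>
      Equiv.Perm.SameCycle.merge hab hinc hne
    have h2 : ∀ x, (G.tourPerm A).SameCycle (.inc δ) x →
        (G.tourPerm (insert δ A)).SameCycle (.out δ) x := fun x =>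
      Equiv.Perm.SameCycle.merge (fun h => hab h.symm) hout (fun x h h' => hne x h' h)
    have h3 := h1 _ (Equiv.Perm.SameCycle.refl _ _)
    have h4 := (ih (.out δ) hs).symm
    intro x hx
    rw [hA.rootComponent_insert hs] at hx
    -- Pass from `κ` to the endpoint half of `δ`; the new vertex was a full cycle of the old walk,
    -- and the old component is covered by induction.
    refine (h1 _ h4).symm.trans ?_
    rcases hx with hx | hx
    · refine h3.trans (h2 x (sameCycle_tourPerm_of_notMem hA ht hx.symm))
    · exact h1 x (h4.trans (ih x hx))

/-- At a leaf, all edges that leave the root component have been skipped. -/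
theorem IsLeaf.mem_of_leaves [Finite C] (hκ : G.dual.tgt κ = r₀) {A S : Set C}
    (h : G.IsLeaf r₀ κ A S) {c : C} (hs : G.dual.src c ∈ G.dual.rootComponent r₀ A)
    (ht : G.dual.tgt c ∉ G.dual.rootComponent r₀ A) : c ∈ S := by
  classical
  by_contra hc
  have hcan := (canAugment_iff h.1.isArborescence).2 ⟨hc, hs, ht⟩
  obtain ⟨n, hn⟩ := (h.1.sameCycle_tourPerm hκ (.out c) hs).exists_nat_pow_eq
  have hex : ∃ n, G.CanAugment r₀ A S (G.tourEdge κ A n) := by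
    refine ⟨n, ?_⟩
    have hP : G.tourStep A = G.tourPerm A := funext fun h => (tourPerm_apply A h).symm
    rw [tourEdge, hP, Equiv.Perm.iterate_eq_pow, hn]
    exact hcan
  exact h.2 _ ⟨Nat.find hex, rfl, Nat.find_spec hex, fun m hm => Nat.find_min hex hm⟩

/-- Descending in the tree of arborescences, so that a given property is kept, ends at a leaf. -/
theorem exists_isLeaf [Finite C] (P : Set C → Set C → Prop) (h0 : P ∅ ∅)
    (hP : ∀ A S δ, G.IsNode r₀ κ A S → P A S → G.IsAugmentingEdge r₀ κ A S δ →
      P (insert δ A) S ∨ P A (insert δ S)) : ∃ A S, G.IsLeaf r₀ κ A S ∧ P A S := by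
  -- Induction on the number of edges that are neither added nor skipped.
  suffices H : ∀ n A S, (A ∪ S)ᶜ.ncard = n → G.IsNode r₀ κ A S → P A S →
      ∃ A S, G.IsLeaf r₀ κ A S ∧ P A S from H _ ∅ ∅ rfl .root h0
  intro n
  induction n using Nat.strong_induction_on with
  | _ n ih =>
    intro A S hn hN hAS
    by_cases hδ : ∃ δ, G.IsAugmentingEdge r₀ κ A S δ
    · obtain ⟨δ, hδ⟩ := hδ
      have hlt : (insert δ (A ∪ S))ᶜ.ncard < n := by
        rw [← hn]
        refine Set.ncard_lt_ncard (compl_lt_compl_iff_lt.2 (Set.ssubset_insert ?_)) (Set.toFinite _)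
        rintro (h | h)
        · exact hδ.canAugment.1 h
        · exact hδ.canAugment.2.1 h
      rcases hP A S δ hN hAS hδ with h | h
      · exact ih _ hlt _ _ (by rw [Set.insert_union]) (hN.right hδ) h
      · exact ih _ hlt _ _ (by rw [Set.union_insert]) (hN.left hδ) h
    · exact ⟨A, S, ⟨hN, not_exists.1 hδ⟩, hAS⟩

/-! ### Descendants and the divergence of leaves. -/

variable (G r₀ κ) in
/-- The node `q` is a child of the node `p`. -/
def IsChild (p q : Set C × Set C) : Prop :=
  ∃ δ, G.IsAugmentingEdge r₀ κ p.1 p.2 δ ∧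
    (q = (insert δ p.1, p.2) ∨ q = (p.1, insert δ p.2))

variable (G r₀ κ) in
/-- The node `q` lies in the subtree below `p`. -/
def IsDescendant (p q : Set C × Set C) : Prop :=
  Relation.ReflTransGen (G.IsChild r₀ κ) p q

theorem IsNode.isDescendant {A S : Set C} (h : G.IsNode r₀ κ A S) :
    G.IsDescendant r₀ κ (∅, ∅) (A, S) := by
  induction h with
  | root => exact .refl
  | right _ hδ ih => exact ih.tail ⟨_, hδ, Or.inl rfl⟩
  | left _ hδ ih => exact ih.tail ⟨_, hδ, Or.inr rfl⟩

theorem IsDescendant.subset {p q : Set C × Set C} (h : G.IsDescendant r₀ κ p q) :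
    p.1 ⊆ q.1 ∧ p.2 ⊆ q.2 := by
  induction h with
  | refl => exact ⟨subset_rfl, subset_rfl⟩
  | tail _ h ih =>
    obtain ⟨δ, -, rfl | rfl⟩ := h
    · exact ⟨ih.1.trans (Set.subset_insert _ _), ih.2⟩
    · exact ⟨ih.1, ih.2.trans (Set.subset_insert _ _)⟩

/-- Once a vertex has been reached, the skipped edges that point to it do not change. -/
theorem IsDescendant.inCount_eq {p q : Set C × Set C} (h : G.IsDescendant r₀ κ p q)
    (hp : G.IsNode r₀ κ p.1 p.2) (r : {r : G.Region // r ≠ r₀})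
    (hr : r.1 ∈ G.dual.rootComponent r₀ p.1) :
    G.dual.inCount r₀ q.2 r = G.dual.inCount r₀ p.2 r := by
  suffices H : G.IsNode r₀ κ q.1 q.2 ∧ r.1 ∈ G.dual.rootComponent r₀ q.1 ∧
    G.dual.inCount r₀ q.2 r = G.dual.inCount r₀ p.2 r from H.2.2
  induction h with
  | refl => exact ⟨hp, hr, rfl⟩
  | tail _ h ih =>
    obtain ⟨hN, hr', hc⟩ := ih
    obtain ⟨δ, hδ, rfl | rfl⟩ := h
    · exact ⟨hN.right hδ, rootComponent_mono (Set.subset_insert _ _) hr', hc⟩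
    · refine ⟨hN.left hδ, hr', ?_⟩
      rw [← hc]
      refine inCount_insert_of_ne fun h => ?_
      exact ((canAugment_iff hN.isArborescence).1 hδ.canAugment).2.2 (h ▸ hr')

/-- Two different leaves lie below different children of some node. -/
theorem IsDescendant.eq_or_diverge {p q q' : Set C × Set C} (h : G.IsDescendant r₀ κ p q)
    (h' : G.IsDescendant r₀ κ p q') (hp : G.IsNode r₀ κ p.1 p.2)
    (hq : ∀ δ, ¬ G.IsAugmentingEdge r₀ κ q.1 q.2 δ)
    (hq' : ∀ δ, ¬ G.IsAugmentingEdge r₀ κ q'.1 q'.2 δ) :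
    q = q' ∨ ∃ B T δ, G.IsNode r₀ κ B T ∧ G.IsAugmentingEdge r₀ κ B T δ ∧
      (G.IsDescendant r₀ κ (insert δ B, T) q ∧ G.IsDescendant r₀ κ (B, insert δ T) q' ∨
        G.IsDescendant r₀ κ (insert δ B, T) q' ∧ G.IsDescendant r₀ κ (B, insert δ T) q) := by
  induction h using Relation.ReflTransGen.head_induction_on with
  | refl =>
    rcases Relation.ReflTransGen.cases_head h' with h' | ⟨_, ⟨δ, hδ, -⟩, -⟩
    · exact Or.inl h'
    · exact absurd hδ (hq δ)
  | @head p p₁ hpp hpq ih =>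
    obtain ⟨δ, hδ, hp₁⟩ := hpp
    rcases Relation.ReflTransGen.cases_head h' with rfl | ⟨p₂, ⟨δ', hδ', hp₂⟩, hpq'⟩
    · exact absurd hδ (hq' δ)
    -- Both paths continue from the same node with the same augmenting edge, so they share the next
    -- child or diverge here.
    · obtain rfl := hδ.unique hδ'
      rcases hp₁ with rfl | rfl <;> rcases hp₂ with rfl | rfl
      · exact ih hpq' (hp.right hδ)
      · exact Or.inr ⟨p.1, p.2, δ, hp, hδ, Or.inl ⟨hpq, hpq'⟩⟩
      · exact Or.inr ⟨p.1, p.2, δ, hp, hδ, Or.inr ⟨hpq', hpq⟩⟩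
      · exact ih hpq' (hp.left hδ)

/-- A symmetric property that rules out the divergence of two leaves makes them equal. -/
theorem IsLeaf.eq_of_not_diverge {A S A' S' : Set C} (h : G.IsLeaf r₀ κ A S)
    (h' : G.IsLeaf r₀ κ A' S') (P : Set C × Set C → Set C × Set C → Prop)
    (hP : ∀ B T δ q q', G.IsNode r₀ κ B T → G.IsAugmentingEdge r₀ κ B T δ →
      G.IsNode r₀ κ q'.1 q'.2 → G.IsDescendant r₀ κ (insert δ B, T) q →
      G.IsDescendant r₀ κ (B, insert δ T) q' → ¬ P q q')
    (h1 : P (A, S) (A', S')) (h2 : P (A', S') (A, S)) : A = A' ∧ S = S' := by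
  rcases h.1.isDescendant.eq_or_diverge h'.1.isDescendant .root h.2 h'.2 with
    hh | ⟨B, T, δ, hN, hδ, ⟨hq, hq'⟩ | ⟨hq, hq'⟩⟩
  · exact Prod.mk.inj hh
  · exact absurd h1 (hP B T δ _ _ hN hδ h'.1 hq hq')
  · exact absurd h2 (hP B T δ _ _ hN hδ h.1 hq hq')

/-- A type I leaf is determined by its arborescence. -/
theorem IsLeaf.skipped_unique {A S S' : Set C} (h : G.IsLeaf r₀ κ A S)
    (h' : G.IsLeaf r₀ κ A S') : S = S' := by
  refine (h.eq_of_not_diverge h' (fun q q' => q.1 = q'.1) ?_ rfl rfl).2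
  intro B T δ q q' _ _ hN' hq hq' heq
  exact Set.disjoint_left.1 hN'.disjoint (heq ▸ hq.subset.1 (Set.mem_insert δ B))
    (hq'.subset.2 (Set.mem_insert δ T))

/-- A leaf is determined by the numbers of skipped edges at the vertices. -/
theorem IsLeaf.eq_of_inCount_eq [Finite C] {A S A' S' : Set C} (h : G.IsLeaf r₀ κ A S)
    (h' : G.IsLeaf r₀ κ A' S') (heq : G.dual.inCount r₀ S = G.dual.inCount r₀ S') :
    A = A' ∧ S = S' := by
  refine h.eq_of_not_diverge h' (fun q q' => G.dual.inCount r₀ q.2 = G.dual.inCount r₀ q'.2) ?_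
    heq heq.symm
  intro B T δ q q' hN hδ _ hq hq' heq
  obtain ⟨hδT, hs, ht⟩ := (canAugment_iff hN.isArborescence).1 hδ.canAugment
  let r : {r : G.Region // r ≠ r₀} :=
    ⟨G.dual.tgt δ, fun h => ht (h.symm ▸ root_mem_rootComponent r₀ B)⟩
  -- On the side that adds `δ`, the count at its endpoint stays at its value for `T`; on the other
  -- side it is at least one larger.
  have h1 := hq.inCount_eq (hN.right hδ) r
    (by rw [hN.isArborescence.rootComponent_insert hs]; exact Or.inl rfl)
  have h2 := inCount_mono (J := G.dual) hq'.subset.2 r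
  have h3 := inCount_insert_of_eq (J := G.dual) hδT (r := r) rfl
  have h4 := congrFun heq r
  simp only at h1 h2
  omega

/-! ### The parking inequality and the existence of leaves. -/

/-- If the arborescence of a node has reached a set `T` of vertices, then it has reached
a vertex of `T` at which the inequality for a parking function holds. -/
theorem IsNode.exists_inCount_lt [Finite C] (T : Set {r : G.Region // r ≠ r₀}) {A S : Set C}
    (h : G.IsNode r₀ κ A S) : (∀ r ∈ T, r.1 ∉ G.dual.rootComponent r₀ A) ∨
      ∃ r ∈ T, r.1 ∈ G.dual.rootComponent r₀ A ∧
        G.dual.inCount r₀ S r < G.dual.relInDegree (Subtype.val '' T) r := by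
  induction h with
  | root => exact Or.inl fun r _ hr => r.2 (eq_of_mem_rootComponent_empty hr)
  | @right A S δ hN hδ ih =>
    obtain ⟨hδS, hs, ht⟩ := (canAugment_iff hN.isArborescence).1 hδ.canAugment
    rw [hN.isArborescence.rootComponent_insert hs]
    rcases ih with ih | ⟨r, hrT, hr, hlt⟩
    · by_cases hT : ∃ r ∈ T, r.1 = G.dual.tgt δ
      -- Here `T` is entered for the first time: all skipped edges start outside `T`, and so does
      -- `δ`, which is not skipped and makes the inequality strict.
      · obtain ⟨r, hrT, hr⟩ := hT
        refine Or.inr ⟨r, hrT, Or.inl hr, Set.ncard_lt_ncard ?_ (Set.toFinite _)⟩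
        have hout : ∀ x ∈ G.dual.rootComponent r₀ A, x ∉ Subtype.val '' T := by
          rintro _ hx ⟨x, hxT, rfl⟩
          exact ih x hxT hx
        have hsub : {c | c ∈ S ∧ G.dual.tgt c = r} ⊆
            {c | G.dual.tgt c = r ∧ G.dual.src c ∉ Subtype.val '' T} :=
          fun c hc => ⟨hc.2, hout _ (hN.src_mem c hc.1)⟩
        exact (Set.ssubset_iff_of_subset hsub).2 ⟨δ, ⟨hr.symm, hout _ hs⟩, fun h => hδS h.1⟩
      · refine Or.inl ?_
        rintro r hrT (hr | hr)
        · exact hT ⟨r, hrT, hr⟩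
        · exact ih r hrT hr
    · exact Or.inr ⟨r, hrT, Or.inr hr, hlt⟩
  | @left A S δ hN hδ ih =>
    refine ih.imp_right ?_
    rintro ⟨r, hrT, hr, hlt⟩
    refine ⟨r, hrT, hr, ?_⟩
    rwa [inCount_insert_of_ne]
    rintro h
    exact ((canAugment_iff hN.isArborescence).1 hδ.canAugment).2.2 (h ▸ hr)

/-- The skipped edges of a type I leaf define a parking function. -/
theorem IsTypeILeaf.isParkingFunction [Finite C] {A S : Set C} (h : G.IsTypeILeaf r₀ κ A S) :
    G.dual.IsParkingFunction r₀ (G.dual.inCount r₀ S) := by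
  intro T ⟨t, ht⟩
  rcases h.1.1.exists_inCount_lt T with hT | ⟨r, hrT, -, hlt⟩
  · exact absurd (h.2.2 _) (hT t ht)
  · exact ⟨r, hrT, hlt⟩

/-- Each spanning arborescence occurs at a leaf. -/
theorem exists_isLeaf_of_isSpanningArborescence [Finite C] (hκ : G.dual.tgt κ = r₀) {A : Set C}
    (hA : G.dual.IsSpanningArborescence r₀ A) : ∃ S, G.IsLeaf r₀ κ A S := by
  obtain ⟨A', S, hL, hsub, hdisj⟩ := exists_isLeaf (G := G) (r₀ := r₀) (κ := κ)
    (fun A' S => A' ⊆ A ∧ Disjoint S A) ⟨Set.empty_subset _, disjoint_bot_left⟩ (by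
      intro A' S δ _ hI _
      by_cases hδ : δ ∈ A
      · exact Or.inl ⟨Set.insert_subset hδ hI.1, hI.2⟩
      · exact Or.inr ⟨hI.1, Set.disjoint_insert_left.2 ⟨hδ, hI.2⟩⟩)
  obtain rfl : A' = A := by
    refine hA.1.eq_of_subset hsub fun r => ?_
    by_contra hr
    -- A path in `A` to a missed vertex leaves the root component by an edge that the leaf has
    -- skipped, but only edges outside of `A` were skipped.
    obtain ⟨c, hc, hs, ht⟩ := (hA.1.reachable r (hA.2 r)).exists_leaving_edge
      (root_mem_rootComponent r₀ A') hr
    exact Set.disjoint_left.1 hdisj (hL.mem_of_leaves hκ hs ht) hc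
  exact ⟨S, hL⟩

/-- Each parking function arises from a type I leaf. -/
theorem exists_isTypeILeaf_of_isParkingFunction [Finite C] (hκ : G.dual.tgt κ = r₀)
    {π : {r : G.Region // r ≠ r₀} → ℕ} (hπ : G.dual.IsParkingFunction r₀ π) :
    ∃ A S, G.IsTypeILeaf r₀ κ A S ∧ G.dual.inCount r₀ S = π := by
  obtain ⟨A, S, hL, hle, heq⟩ := exists_isLeaf (G := G) (r₀ := r₀) (κ := κ)
    (fun A S => (∀ r, G.dual.inCount r₀ S r ≤ π r) ∧
      ∀ r, r.1 ∈ G.dual.rootComponent r₀ A → G.dual.inCount r₀ S r = π r)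
    ⟨fun r => by simp [inCount], fun r hr => absurd (eq_of_mem_rootComponent_empty hr) r.2⟩ (by
      intro A S δ hN ⟨hle, heq⟩ hδ
      obtain ⟨hδS, hs, ht⟩ := (canAugment_iff hN.isArborescence).1 hδ.canAugment
      -- Add `δ` if its endpoint has its full quota `π` of skipped edges, otherwise skip it.
      by_cases h : ∀ r : {r : G.Region // r ≠ r₀}, r.1 = G.dual.tgt δ →
        G.dual.inCount r₀ S r = π r
      · refine Or.inl ⟨hle, fun r hr => ?_⟩
        rw [hN.isArborescence.rootComponent_insert hs] at hr
        exact hr.elim (h r) (heq r)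
      · push Not at h
        obtain ⟨r, hr, hne⟩ := h
        refine Or.inr ⟨fun r' => ?_, fun r' hr' => ?_⟩
        · by_cases hrr : r' = r
          · subst hrr
            rw [inCount_insert_of_eq hδS hr.symm]
            exact lt_of_le_of_ne (hle r') hne
          · rw [inCount_insert_of_ne fun h => hrr (Subtype.ext (h.symm.trans hr.symm))]
            exact hle r'
        · rw [inCount_insert_of_ne fun h => ht (h ▸ hr')]
          exact heq r' hr')
  have hspan : ∀ r, r ∈ G.dual.rootComponent r₀ A := by
    intro r
    by_contra hr
    -- Test `π` on the unreached vertices. The edges into `t` from outside this set leave the root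
    -- component, so all were skipped, and there are at most `π t` of them.
    obtain ⟨t, htT, hlt⟩ := hπ {t | t.1 ∉ G.dual.rootComponent r₀ A}
      ⟨⟨r, fun h => hr (h.symm ▸ root_mem_rootComponent r₀ A)⟩, hr⟩
    refine (hlt.trans_le ?_).not_ge (hle t)
    refine Set.ncard_le_ncard (fun c hc => ⟨?_, hc.1⟩) (Set.toFinite _)
    refine hL.mem_of_leaves hκ ?_ (hc.1 ▸ htT)
    by_contra hs
    exact hc.2 ⟨⟨G.dual.src c, fun h => hs (h.symm ▸ root_mem_rootComponent r₀ A)⟩, hs, rfl⟩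
  exact ⟨A, S, ⟨hL, hL.1.isArborescence, hspan⟩, funext fun r => heq r (hspan r)⟩

end EmbeddedBipartiteGraph

theorem theorem6p3 {E V C : Type*} [Finite E] [Finite V] [Finite C]
    (G : EmbeddedBipartiteGraph E V C) (hG : G.IsConnectedPlane)
    (r₀ : G.Region) (κ : C) (hκ : G.dual.tgt κ = r₀) :
    -- each type I leaf yields a parking function
    (∀ A S : Set C, G.IsTypeILeaf r₀ κ A S →
      G.dual.IsParkingFunction r₀ (G.dual.inCount r₀ S)) ∧
    -- each spanning arborescence belongs to a unique type I leaf
    (∀ A : Set C, G.dual.IsSpanningArborescence r₀ A → ∃! S : Set C, G.IsTypeILeaf r₀ κ A S) ∧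
    -- each parking function arises from a unique spanning arborescence
    (∀ π : {r : G.Region // r ≠ r₀} → ℕ, G.dual.IsParkingFunction r₀ π →
      ∃! A : Set C, G.dual.IsSpanningArborescence r₀ A ∧
        ∃ S : Set C, G.IsTypeILeaf r₀ κ A S ∧ G.dual.inCount r₀ S = π) := by
  refine ⟨fun A S h => h.isParkingFunction, fun A hA => ?_, fun π hπ => ?_⟩
  · obtain ⟨S, hS⟩ := EmbeddedBipartiteGraph.exists_isLeaf_of_isSpanningArborescence hκ hA
    exact ⟨S, ⟨hS, hA⟩, fun S' hS' => hS'.1.skipped_unique hS⟩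
  · obtain ⟨A, S, hL, hS⟩ :=
      EmbeddedBipartiteGraph.exists_isTypeILeaf_of_isParkingFunction hκ hπ
    refine ⟨A, ⟨hL.2, S, hL, hS⟩, ?_⟩
    rintro A' ⟨-, S', hL', hS'⟩
    exact (hL'.1.eq_of_inCount_eq hL.1 (hS'.trans hS.symm)).1
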